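/- For $\lambda\in\mathbb C\setminus\{0\}$ let $E_\lambda(z)=\lambda e^z$. For $\underline\lambda=(\lambda_n)_{n\ge1}$ in $\mathbb C\setminus\{0\}$ and real sequences $\underline a=(a_n)_{n\ge1}$, $\underline b=(b_n)_{n\ge1}$ with $0<a_n<b_n$, put $\Delta_n=\log(b_n/a_n)$ and $$I_{\underline a}^{\underline b}(E_{\underline\lambda})=\{z\in\mathbb C:\ a_n\le|E_{\lambda_n}\circ\cdots\circ E_{\lambda_1}(z)|\le b_n\ \text{for all sufficiently large } n\}.$$ Let $M(E_{\underline\lambda})$, the moderately slow escaping set, be the set of $z\in\mathbb C$ such that $|E_{\lambda_n}\circ\cdots\circ E_{\lambda_1}(z)|\to\infty$ as $n\to\infty$ and $\limsup_{n\to\infty}\frac1n\log\log|E_{\lambda_n}\circ\cdots\circ E_{\lambda_1}(z)|<\infty$. **Theorem.** For every $\Delta>0$ and $q\in(0,1)$ there is a constant $a_*$, depending only on $\Delta$ and $q$, such that the following holds for all $\underline\lambda,\underline a,\underline b$ as above. Assume that (a) $a_{n+1}\le|\lambda_{n+1}|e^{qa_n}$ and $b_{n+1}\ge|\lambda_{n+1}|e^{-qa_n}$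 for all sufficiently large $n$; (b) $(a_1\cdots a_n)^{1/n}\to\infty$ as $n\to\infty$; (c) $\Delta_n>\Delta$ for all $n\ge1$; (d) $\liminf_{n\to\infty}a_n>a_*$. If $\liminf_{n\to\infty}(\log^+ b_n)^{1/n}<\infty$, where $\log^+=\max(\log,0)$, then $\dim_H I_{\underline a}^{\underline b}(E_{\underline\lambda})=1$. Also, if $I_{\underline a}^{\underline b}(E_{\underline\lambda})\subset M(E_{\underline\lambda})$, then $\dim_H I_{\underline a}^{\underline b}(E_{\underline\lambda})=1$. -/

import Mathlib

open Filter Topology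

noncomputable section

/-- The exponential map `E_μ(z) = μ e^z`. -/
def expMap (μ : ℂ) (z : ℂ) : ℂ := μ * Complex.exp z

/-- The composition `E_{λ_n} ∘ ⋯ ∘ E_{λ_1}`. Sequences `(λ_n)_{n ≥ 1}` are modelled by functions
on `ℕ` whose value at the index `0` is never used. -/
def expIter (lam : ℕ → ℂ) : ℕ → ℂ → ℂ
  | 0 => id
  | n + 1 => expMap (lam (n + 1)) ∘ expIter lam n

/-- The set of points `z` with `a_n ≤ |E_{λ_n} ∘ ⋯ ∘ E_{λ_1}(z)| ≤ b_n` for all sufficiently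
large `n`. -/
def rateSet (lam : ℕ → ℂ) (a b : ℕ → ℝ) : Set ℂ :=
  {z | ∀ᶠ n in atTop, a n ≤ ‖expIter lam n z‖ ∧ ‖expIter lam n z‖ ≤ b n}

/-- The escaping set. -/
def escapingSet (lam : ℕ → ℂ) : Set ℂ :=
  {z | Tendsto (fun n => ‖expIter lam n z‖) atTop atTop}

/-- The moderately slow escaping set: the escaping points with
`limsup (1/n) log log |E_{λ_n} ∘ ⋯ ∘ E_{λ_1}(z)| < ∞`. The limsup is taken in the extended reals. -/
def modSlowEscapingSet (lam : ℕ → ℂ) : Set ℂ :=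
  {z ∈ escapingSet lam |
    limsup (fun n : ℕ =>
      (((1 / (n : ℝ)) * Real.log (Real.log ‖expIter lam n z‖) : ℝ) : EReal)) atTop < ⊤}

/-- The sequences `a`, `b` are admissible with the constant `q`. -/
def AdmissibleWith (lam : ℕ → ℂ) (a b : ℕ → ℝ) (q : ℝ) : Prop :=
  ∀ᶠ n in atTop,
    a (n + 1) ≤ ‖lam (n + 1)‖ * Real.exp (q * a n) ∧
    ‖lam (n + 1)‖ * Real.exp (-(q * a n)) ≤ b (n + 1)

/-- The normalized modulus `Δ_n = log (b_n / a_n)` of the annulus `a_n ≤ |z| ≤ b_n`. -/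
def annulusModulus (a b : ℕ → ℝ) (n : ℕ) : ℝ := Real.log (b n / a n)

end

/-! The bounds by 1 from above and below are proved separately. Conditions that hold only eventually
are handled by starting at a late time, since preimages under `expIter` preserve dimension.

Upper bound. Fix s > 1. One exponential pulls a disc of radius r about p back to discs of radius
2r/|p| about points g_k spaced by 2πi, and the sum of |g_k|^(-s) over |g_k| ≥ a_n/2 is
O(a_n^(-(s-1)/2)). Iterating (`content_trackingSet_le`) bounds the content by a product of such
factors, which decays faster than any geometric sequence because the geometric means of the a_n tend
to infinity. If the modulus at time n is at most exp(C^n), the preceding point lies in a strip of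
width C^n, covered by about C^n columns of unit discs (`content_bounded_at_le`). The resulting
series converges, so Borel-Cantelli gives a null set. Either growth hypothesis supplies such a C for
every point and infinitely many n.

Lower bound. Shrink to annuli a_n ≤ |z| ≤ a_n e^δ. The logarithmic preimage of the next annulus is a
strip of width δ, and admissibility keeps the strip away from the vertical tangents of the current
annulus, so the two meet in a box containing at least a constant times a_n periods
(`exists_box_in_annulus`). Choosing a period at each time codes points by digit sequences; the
derivative bound separates different codes. Reading codes in mixed radix maps onto [0,1) with Hölder
exponent τ for every τ < 1 (`one_le_dimH_of_separated_coding`), so the dimension is at least 1. -/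

open Filter Topology
-- Hausdorff content and null sets
open MeasureTheory in
/-- The `s`-dimensional Hausdorff content. -/
noncomputable def hausdorffContent (s : ℝ) : OuterMeasure ℂ :=
  OuterMeasure.boundedBy fun A => Metric.ediam A ^ s

open MeasureTheory in
theorem hausdorffContent_closedBall_le {s : ℝ} (hs : 0 ≤ s) (p : ℂ) {r : ℝ} (hr : 0 ≤ r) :
    hausdorffContent s (Metric.closedBall p r) ≤ ENNReal.ofReal ((2 * r) ^ s) := by
  refine (OuterMeasure.boundedBy_le _).trans ?_
  rw [← ENNReal.ofReal_rpow_of_nonneg (by positivity) hs]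
  gcongr
  refine Metric.ediam_le_of_forall_dist_le fun x hx y hy => ?_
  have := dist_triangle_right x y p
  rw [Metric.mem_closedBall] at hx hy
  linarith

-- A cover whose sum of diam^s is below r^s consists of sets of diameter at most r, so it is also
-- admissible for the measure at scale r.
open MeasureTheory in
theorem hausdorffMeasure_eq_zero_of_content {s : ℝ} (hs : 0 < s) {A : Set ℂ}
    (hA : hausdorffContent s A = 0) : μH[s] A = 0 := by
  rw [Measure.hausdorffMeasure_apply]
  simp only [ENNReal.iSup_eq_zero]
  intro r hr
  refine le_antisymm (ENNReal.le_of_forall_pos_le_add fun ε hε _ => ?_) bot_le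
  have hpos : 0 < min (ε : ENNReal) (r ^ s) :=
    lt_min (by exact_mod_cast hε) (ENNReal.rpow_pos_of_nonneg hr hs.le)
  rw [← hA, hausdorffContent, OuterMeasure.boundedBy_apply] at hpos
  simp only [iInf_lt_iff] at hpos
  obtain ⟨t, ht, hlt⟩ := hpos
  have hd : ∀ n, Metric.ediam (t n) ≤ r := by
    intro n
    rcases (t n).eq_empty_or_nonempty with h | h
    · simp [h]
    · have h1 := (ENNReal.le_tsum n).trans (hlt.le.trans (min_le_right _ _))
      rw [iSup_pos h] at h1
      exact (ENNReal.rpow_le_rpow_iff hs).1 h1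
  rw [zero_add]
  exact (iInf₂_le_of_le t ht (iInf_le _ hd)).trans (hlt.le.trans (min_le_left _ _))

/-! ### Inverse branches of the exponential map -/

-- The exponent s splits as (s+1)/2 + (s-1)/2: the first part exceeds 1 and makes the series
-- summable, the second yields decay in c.
open ENNReal in
theorem exists_tsum_progression_le {s : ℝ} (hs : 1 < s) :
    ∃ K : ℝ, 0 < K ∧ ∀ (g : ℤ → ℂ) (c : ℝ), 1 ≤ c → (∀ k : ℤ, |(k : ℝ)| ≤ ‖g k‖) →
      ∑' k : ℤ, (if c ≤ ‖g k‖ then ENNReal.ofReal (‖g k‖ ^ (-s)) else 0) ≤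
        ENNReal.ofReal (K * c ^ (-((s - 1) / 2))) := by
  have hb : 1 < (s + 1) / 2 := by linarith
  -- The indicator of k = 0 is needed because 0 to a nonzero power is 0 here.
  set F : ℤ → ℝ := fun k => |(k : ℝ)| ^ (-((s + 1) / 2)) + if k = 0 then 1 else 0 with hF
  have hsum : Summable F :=
    (Real.summable_abs_int_rpow hb).add (summable_of_ne_finset_zero (s := {0}) (by simp +contextual))
  have hF0 : ∀ k, 0 ≤ F k := fun k => by simp only [hF]; positivity
  refine ⟨∑' k, F k + 1, add_pos_of_nonneg_of_pos (tsum_nonneg hF0) one_pos, fun g c hc hg => ?_⟩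
  have key : ∀ k : ℤ, (if c ≤ ‖g k‖ then ENNReal.ofReal (‖g k‖ ^ (-s)) else 0) ≤
      ENNReal.ofReal (F k * c ^ (-((s - 1) / 2))) := by
    intro k
    split_ifs with h
    · apply ENNReal.ofReal_le_ofReal
      have h0 : 0 < ‖g k‖ := by linarith
      have e : -s = -((s + 1) / 2) + -((s - 1) / 2) := by ring
      rw [e, Real.rpow_add h0]
      gcongr ?_ * ?_
      · by_cases hk : k = 0
        · simp only [hF, hk, if_true]
          have h1 : 1 ≤ ‖g 0‖ := by rw [hk] at h; linarith
          refine (Real.rpow_le_one_of_one_le_of_nonpos h1 (by linarith)).trans ?_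
          have : 0 ≤ |((0 : ℤ) : ℝ)| ^ (-((s + 1) / 2)) := by positivity
          linarith
        · simp only [hF, hk, if_false, add_zero]
          have : (0 : ℝ) < |(k : ℝ)| := by positivity
          exact Real.rpow_le_rpow_of_nonpos this (hg k) (by linarith)
      · exact Real.rpow_le_rpow_of_nonpos (by linarith) h (by linarith)
    · exact bot_le
  calc _ ≤ ∑' k, ENNReal.ofReal (F k * c ^ (-((s - 1) / 2))) := ENNReal.tsum_le_tsum key
    _ = ENNReal.ofReal (∑' k, F k * c ^ (-((s - 1) / 2))) :=
        (ENNReal.ofReal_tsum_of_nonneg (fun k => mul_nonneg (hF0 k) (by positivity))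
          (hsum.mul_right _)).symm
    _ ≤ _ := by
        apply ENNReal.ofReal_le_ofReal
        rw [tsum_mul_right]
        gcongr
        linarith

theorem exists_preimages_expMap {μ p : ℂ} (hμ : μ ≠ 0) (hp : p ≠ 0) :
    ∃ g : ℤ → ℂ, (∀ k : ℤ, |(k : ℝ)| ≤ ‖g k‖) ∧ ∀ z, expMap μ z = p → ∃ k, z = g k := by
  refine ⟨fun k => Complex.log (p / μ) + k * (2 * Real.pi * Complex.I), fun k => ?_, fun z hz => ?_⟩
  · refine le_trans ?_ (Complex.abs_im_le_norm _)
    have him : (Complex.log (p / μ) + k * (2 * Real.pi * Complex.I)).im =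
        Complex.arg (p / μ) + k * (2 * Real.pi) := by
      simp [Complex.log_im]
    rw [him]
    by_cases hk : k = 0
    · simp [hk]
    have h1 : (1 : ℝ) ≤ |(k : ℝ)| := by exact_mod_cast Int.one_le_abs hk
    have h2 := Complex.abs_arg_le_pi (p / μ)
    have h3 : |(k : ℝ) * (2 * Real.pi)| = |(k : ℝ)| * (2 * Real.pi) := by
      rw [abs_mul, abs_of_pos Real.two_pi_pos]
    have h4 := abs_sub_abs_le_abs_sub ((k : ℝ) * (2 * Real.pi)) (-Complex.arg (p / μ))
    rw [abs_neg, sub_neg_eq_add, add_comm ((k : ℝ) * _)] at h4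
    nlinarith [Real.pi_gt_three]
  · have h : Complex.exp z = Complex.exp (Complex.log (p / μ)) := by
      rw [Complex.exp_log (div_ne_zero hp hμ), eq_div_iff hμ, ← hz, expMap, mul_comm]
    exact Complex.exp_eq_exp_iff_exists_int.1 h

/-- Write the image as p(1 + t) with |t| ≤ 1/2 and subtract log(1 + t), whose modulus is at most
3|t|/2. -/
theorem exists_preimage_near {μ p z : ℂ} {r : ℝ} (hp : p ≠ 0) (hr : r ≤ ‖p‖ / 2)
    (hz : expMap μ z ∈ Metric.closedBall p r) :
    ∃ z', expMap μ z' = p ∧ z ∈ Metric.closedBall z' (2 * r / ‖p‖) := by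
  have hp' : 0 < ‖p‖ := norm_pos_iff.2 hp
  rw [Metric.mem_closedBall, dist_eq_norm] at hz
  set t := (expMap μ z - p) / p with ht
  have htn : ‖t‖ ≤ r / ‖p‖ := by rw [ht, norm_div]; gcongr
  have ht2 : ‖t‖ ≤ 1 / 2 := htn.trans (by rw [div_le_iff₀ hp']; linarith)
  have h1 : (1 + t) ≠ 0 := by
    intro h
    have : t = -1 := by linear_combination h
    rw [this] at ht2; norm_num at ht2
  refine ⟨z - Complex.log (1 + t), ?_, ?_⟩
  · have : expMap μ z = p * (1 + t) := by rw [ht]; field_simp; ring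
    rw [expMap, Complex.exp_sub, Complex.exp_log h1, ← mul_div_assoc]
    change expMap μ z / _ = p
    rw [this, mul_div_cancel_right₀ _ h1]
  · rw [Metric.mem_closedBall, dist_eq_norm]
    have e : z - (z - Complex.log (1 + t)) = Complex.log (1 + t) := by ring
    rw [e]
    refine (Complex.norm_log_one_add_half_le_self ht2).trans ?_
    rw [mul_div_assoc]
    have := norm_nonneg t
    linarith

/-! ### Upper bound: content of sets of tracked orbits -/

/-- The products `∏ i < n, a i` grow faster than every geometric sequence. -/
def SuperGeometric (a : ℕ → ℝ) : Prop :=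
  ∀ B : ℝ, 0 < B → ∃ C : ℝ, 0 < C ∧ ∀ n, B ^ n ≤ C * ∏ i ∈ Finset.range n, a i

theorem SuperGeometric.exists_prod_rpow_le {a : ℕ → ℝ} (h : SuperGeometric a) (ha : ∀ n, 0 < a n)
    {G ε : ℝ} (hG : 0 < G) (hε : 0 < ε) :
    ∃ C : ℝ, 0 < C ∧ ∀ n, ∏ i ∈ Finset.range n, (G * a i ^ (-ε)) ≤ C := by
  obtain ⟨C, hC, hle⟩ := h (G ^ (1 / ε)) (by positivity)
  refine ⟨C ^ ε, by positivity, fun n => ?_⟩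
  have hP : 0 < ∏ i ∈ Finset.range n, a i := Finset.prod_pos fun i _ => ha i
  rw [Finset.prod_mul_distrib, Finset.prod_const, Finset.card_range,
    Real.finsetProd_rpow _ _ (fun i _ => (ha i).le), Real.rpow_neg hP.le, ← div_eq_mul_inv,
    div_le_iff₀ (by positivity), ← Real.mul_rpow hC.le hP.le]
  refine le_trans (le_of_eq ?_) (Real.rpow_le_rpow (by positivity) (hle n) hε.le)
  rw [← Real.rpow_natCast, ← Real.rpow_natCast, ← Real.rpow_mul hG.le, ← Real.rpow_mul hG.le]
  congr 1
  field_simp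

theorem expIter_succ (lam : ℕ → ℂ) (n : ℕ) (z : ℂ) :
    expIter lam (n + 1) z = expMap (lam (n + 1)) (expIter lam n z) := rfl

/-- Bounded starting points whose orbit respects the lower bounds up to time `n` and is in a given
disc at time `n`. -/
def trackingSet (lam : ℕ → ℂ) (a : ℕ → ℝ) (R : ℝ) (n : ℕ) (p : ℂ) (r : ℝ) : Set ℂ :=
  {w | ‖w‖ ≤ R ∧ (∀ k ≤ n, a k ≤ ‖expIter lam k w‖) ∧ expIter lam n w ∈ Metric.closedBall p r}

/-- Centres with |g_k| < a_n/2 contribute nothing: the orbit has modulus at least a_n ≥ 4 and lies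
within r ≤ 1 of the centre. The others have modulus at least 2, so `hW` applies. -/
theorem tsum_content_trackingSet_le {lam : ℕ → ℂ} {a : ℕ → ℝ} {s K R D r : ℝ} (hD : 0 ≤ D)
    (hr : 0 ≤ r) (n : ℕ) (ha : 4 ≤ a n) (hr1 : r ≤ 1)
    (hK : ∀ (g : ℤ → ℂ) (c : ℝ), 1 ≤ c → (∀ k : ℤ, |(k : ℝ)| ≤ ‖g k‖) →
      ∑' k : ℤ, (if c ≤ ‖g k‖ then ENNReal.ofReal (‖g k‖ ^ (-s)) else 0) ≤
        ENNReal.ofReal (K * c ^ (-((s - 1) / 2))))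
    (hW : ∀ p : ℂ, 2 ≤ ‖p‖ →
      hausdorffContent s (trackingSet lam a R n p r) ≤ ENNReal.ofReal (D * r ^ s * ‖p‖ ^ (-s)))
    (g : ℤ → ℂ) (hg : ∀ k : ℤ, |(k : ℝ)| ≤ ‖g k‖) {A : Set ℂ}
    (hA : A ⊆ ⋃ k, trackingSet lam a R n (g k) r) :
    hausdorffContent s A ≤
      ENNReal.ofReal (D * r ^ s * (K * (a n / 2) ^ (-((s - 1) / 2)))) := by
  have key : ∀ k, hausdorffContent s (trackingSet lam a R n (g k) r) ≤
      ENNReal.ofReal (D * r ^ s) *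
        (if a n / 2 ≤ ‖g k‖ then ENNReal.ofReal (‖g k‖ ^ (-s)) else 0) := by
    intro k
    split_ifs with h
    · rw [← ENNReal.ofReal_mul (by positivity)]
      exact hW _ (by linarith)
    · have : trackingSet lam a R n (g k) r = ∅ := by
        refine Set.eq_empty_of_forall_notMem fun w hw => h ?_
        have h1 := hw.2.1 n le_rfl
        have h2 := hw.2.2
        rw [Metric.mem_closedBall, dist_eq_norm] at h2
        have h3 := norm_sub_norm_le (expIter lam n w) (g k)
        linarith
      simp [this]
  calc _ ≤ hausdorffContent s (⋃ k, trackingSet lam a R n (g k) r) := MeasureTheory.measure_mono hA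
    _ ≤ ∑' k, hausdorffContent s (trackingSet lam a R n (g k) r) := MeasureTheory.measure_iUnion_le _
    _ ≤ ∑' k, ENNReal.ofReal (D * r ^ s) *
          (if a n / 2 ≤ ‖g k‖ then ENNReal.ofReal (‖g k‖ ^ (-s)) else 0) :=
        ENNReal.tsum_le_tsum key
    _ ≤ _ := by
        rw [ENNReal.tsum_mul_left, ENNReal.ofReal_mul (p := D * r ^ s) (by positivity)]
        gcongr
        exact hK g _ (by linarith) hg

theorem content_trackingSet_le {lam : ℕ → ℂ} {a : ℕ → ℝ} {s K R : ℝ} (hs : 1 < s) (hK0 : 0 < K)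
    (hR : 0 ≤ R) (hlam : ∀ n, lam (n + 1) ≠ 0) (ha : ∀ n, 4 ≤ a n)
    (hK : ∀ (g : ℤ → ℂ) (c : ℝ), 1 ≤ c → (∀ k : ℤ, |(k : ℝ)| ≤ ‖g k‖) →
      ∑' k : ℤ, (if c ≤ ‖g k‖ then ENNReal.ofReal (‖g k‖ ^ (-s)) else 0) ≤
        ENNReal.ofReal (K * c ^ (-((s - 1) / 2)))) (n : ℕ) :
    ∀ (p : ℂ) (r : ℝ), 2 ≤ ‖p‖ → 0 ≤ r → r ≤ 1 →
      hausdorffContent s (trackingSet lam a R n p r) ≤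
        ENNReal.ofReal ((2 * (R + 1)) ^ s *
          (∏ i ∈ Finset.range n, (2 ^ s * (K * (a i / 2) ^ (-((s - 1) / 2))))) *
          r ^ s * ‖p‖ ^ (-s)) := by
  have ha0 : ∀ n, 0 < a n := fun n => by linarith [ha n]
  induction n with
  | zero =>
    intro p r hp hr hr1
    rcases (trackingSet lam a R 0 p r).eq_empty_or_nonempty with h | ⟨w, hw⟩
    · simp [h]
    -- Boundedness of the starting points pays for the factor ‖p‖^(-s) at the price of (R + 1)^s.
    have hpR : ‖p‖ ≤ R + 1 := by
      have h1 := hw.1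
      have h2 := hw.2.2
      rw [Metric.mem_closedBall, dist_comm, dist_eq_norm] at h2
      have h3 := norm_sub_norm_le p (expIter lam 0 w)
      change ‖p‖ - ‖w‖ ≤ _ at h3
      linarith
    have hp0 : 0 < ‖p‖ := by linarith
    refine (MeasureTheory.measure_mono (fun w hw => hw.2.2 :
      trackingSet lam a R 0 p r ⊆ Metric.closedBall p r)).trans ?_
    refine (hausdorffContent_closedBall_le (by linarith) p hr).trans ?_
    apply ENNReal.ofReal_le_ofReal
    rw [Finset.prod_range_zero, mul_one, Real.mul_rpow (by norm_num) hr,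
      Real.mul_rpow (by norm_num) (by linarith), Real.rpow_neg hp0.le]
    have h1 : 1 ≤ (R + 1) ^ s * (‖p‖ ^ s)⁻¹ := by
      rw [← div_eq_mul_inv, le_div_iff₀ (by positivity), one_mul]
      gcongr
    calc (2 : ℝ) ^ s * r ^ s ≤ 2 ^ s * r ^ s * ((R + 1) ^ s * (‖p‖ ^ s)⁻¹) :=
          le_mul_of_one_le_right (by positivity) h1
      _ = _ := by ring
  | succ n ih =>
    intro p r hp hr hr1
    have hp0 : 0 < ‖p‖ := by linarith
    obtain ⟨g, hg, hgz⟩ := exists_preimages_expMap (hlam n) (norm_pos_iff.1 hp0)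
    have hr' : 2 * r / ‖p‖ ≤ 1 := by rw [div_le_one hp0]; linarith
    have hprod : 0 ≤ ∏ i ∈ Finset.range n, (2 ^ s * (K * (a i / 2) ^ (-((s - 1) / 2)))) :=
      Finset.prod_nonneg fun i _ => by have := ha0 i; positivity
    have := tsum_content_trackingSet_le (lam := lam) (R := R)
      (A := trackingSet lam a R (n + 1) p r) (mul_nonneg (by positivity) hprod)
      (div_nonneg (by linarith) hp0.le) n (ha n) hr' hK
      (fun p' hp' => ih p' _ hp' (by positivity) hr') g hg ?_
    · refine this.trans (ENNReal.ofReal_le_ofReal (le_of_eq ?_))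
      rw [Finset.prod_range_succ, Real.div_rpow (by positivity) hp0.le,
        Real.mul_rpow (by norm_num) hr, Real.rpow_neg hp0.le]
      ring
    · intro w hw
      obtain ⟨z', hz', hwz⟩ := exists_preimage_near (norm_pos_iff.1 hp0)
        (by linarith : r ≤ ‖p‖ / 2) (expIter_succ lam n w ▸ hw.2.2)
      obtain ⟨k, rfl⟩ := hgz z' hz'
      exact Set.mem_iUnion.2 ⟨k, hw.1, fun j hj => hw.2.1 j (by omega), hwz⟩

/-- The points at time n lie in a vertical strip of width T; each column of unit discs with centres
spaced by i costs as much as one more pull-back. -/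
theorem content_bounded_at_le {lam : ℕ → ℂ} {a : ℕ → ℝ} {s K R T : ℝ} (hs : 1 < s) (hK0 : 0 < K)
    (hR : 0 ≤ R) (hT : 0 ≤ T) (hlam : ∀ n, lam (n + 1) ≠ 0) (ha : ∀ n, 4 ≤ a n)
    (hK : ∀ (g : ℤ → ℂ) (c : ℝ), 1 ≤ c → (∀ k : ℤ, |(k : ℝ)| ≤ ‖g k‖) →
      ∑' k : ℤ, (if c ≤ ‖g k‖ then ENNReal.ofReal (‖g k‖ ^ (-s)) else 0) ≤
        ENNReal.ofReal (K * c ^ (-((s - 1) / 2)))) (n : ℕ) :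
    hausdorffContent s {w | ‖w‖ ≤ R ∧ (∀ k, a k ≤ ‖expIter lam k w‖) ∧
        ‖expIter lam (n + 1) w‖ ≤ Real.exp T} ≤
      ENNReal.ofReal ((T + 2) * ((2 * (R + 1)) ^ s *
        ∏ i ∈ Finset.range (n + 1), (2 ^ s * (K * (a i / 2) ^ (-((s - 1) / 2)))))) := by
  have ha0 : ∀ n, 0 < a n := fun n => by linarith [ha n]
  set Q : ℕ → ℝ := fun n => ∏ i ∈ Finset.range n, (2 ^ s * (K * (a i / 2) ^ (-((s - 1) / 2))))
    with hQ
  have hQ0 : ∀ n, 0 ≤ Q n := fun n => Finset.prod_nonneg fun i _ => by have := ha0 i; positivity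
  set β := -Real.log ‖lam (n + 1)‖ with hβ
  have hl : 0 < ‖lam (n + 1)‖ := norm_pos_iff.2 (hlam n)
  set g : ℕ → ℤ → ℂ := fun j k => ⟨β + j, k⟩ with hg
  have hgk : ∀ (j : ℕ) (k : ℤ), |(k : ℝ)| ≤ ‖g j k‖ := fun j k => Complex.abs_im_le_norm (g j k)
  set A : ℕ → Set ℂ := fun j => ⋃ k, trackingSet lam a R n (g j k) 1 with hA
  have hAj : ∀ j, hausdorffContent s (A j) ≤ ENNReal.ofReal ((2 * (R + 1)) ^ s * Q (n + 1)) := by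
    intro j
    have := tsum_content_trackingSet_le (A := A j) (mul_nonneg (by positivity) (hQ0 n)) zero_le_one
      n (ha n) le_rfl hK
      (fun p hp => content_trackingSet_le hs hK0 hR hlam ha hK n p 1 hp zero_le_one le_rfl)
      (g j) (hgk j) le_rfl
    refine this.trans (ENNReal.ofReal_le_ofReal ?_)
    have h2 : (1 : ℝ) ≤ 2 ^ s := Real.one_le_rpow (by norm_num) (by linarith)
    rw [Real.one_rpow, mul_one, hQ]
    simp only [Finset.prod_range_succ]
    have h3 : 0 ≤ K * (a n / 2) ^ (-((s - 1) / 2)) := by have := ha0 n; positivity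
    rw [mul_assoc]
    refine mul_le_mul_of_nonneg_left ?_ (by positivity)
    refine mul_le_mul_of_nonneg_left ?_ (hQ0 n)
    nlinarith
  have hcov : {w | ‖w‖ ≤ R ∧ (∀ k, a k ≤ ‖expIter lam k w‖) ∧
        ‖expIter lam (n + 1) w‖ ≤ Real.exp T} ⊆ ⋃ j ∈ Finset.range (⌊T⌋₊ + 2), A j := by
    rintro w ⟨hw, hwa, hwT⟩
    set u := expIter lam n w with hu
    have hnorm : ‖expIter lam (n + 1) w‖ = Real.exp (u.re - β) := by
      rw [expIter_succ, expMap, norm_mul, Complex.norm_exp, hβ, sub_neg_eq_add,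
        Real.exp_add, Real.exp_log hl, mul_comm]
    have hx0 : 0 ≤ u.re - β := by
      rw [← Real.one_le_exp_iff, ← hnorm]; linarith [hwa (n + 1), ha (n + 1)]
    have hxT : u.re - β ≤ T := by rwa [hnorm, Real.exp_le_exp] at hwT
    set j := ⌊u.re - β + 1 / 2⌋₊ with hj
    have hj1 : (j : ℝ) ≤ u.re - β + 1 / 2 := Nat.floor_le (by linarith)
    have hj2 : u.re - β + 1 / 2 < j + 1 := Nat.lt_floor_add_one _
    -- Rounding to the nearest column can reach ⌊T⌋ + 1, hence the range ⌊T⌋ + 2.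
    have hjT : j < ⌊T⌋₊ + 2 := by
      have := Nat.lt_floor_add_one T
      have : (j : ℝ) < (⌊T⌋₊ + 2 : ℕ) := by push_cast; linarith
      exact_mod_cast this
    refine Set.mem_biUnion (Finset.mem_coe.2 (Finset.mem_range.2 hjT)) ?_
    refine Set.mem_iUnion.2 ⟨round u.im, hw, fun k _ => hwa k, ?_⟩
    rw [Metric.mem_closedBall, dist_eq_norm]
    refine (Complex.norm_le_abs_re_add_abs_im _).trans ?_
    have h1 : |(u - g j (round u.im)).im| ≤ 1 / 2 := by
      simpa [hg] using abs_sub_round u.im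
    have h2 : |(u - g j (round u.im)).re| ≤ 1 / 2 := by
      simp only [hg, Complex.sub_re]
      rw [abs_le]; constructor <;> linarith
    linarith
  calc _ ≤ hausdorffContent s (⋃ j ∈ Finset.range (⌊T⌋₊ + 2), A j) :=
        MeasureTheory.measure_mono hcov
    _ ≤ ∑ j ∈ Finset.range (⌊T⌋₊ + 2), hausdorffContent s (A j) :=
        MeasureTheory.measure_biUnion_finset_le _ _
    _ ≤ ∑ j ∈ Finset.range (⌊T⌋₊ + 2), ENNReal.ofReal ((2 * (R + 1)) ^ s * Q (n + 1)) :=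
        Finset.sum_le_sum fun j _ => hAj j
    _ = ENNReal.ofReal ((⌊T⌋₊ + 2 : ℕ) * ((2 * (R + 1)) ^ s * Q (n + 1))) := by
        rw [Finset.sum_const, Finset.card_range, nsmul_eq_mul,
          ENNReal.ofReal_mul (Nat.cast_nonneg _), ENNReal.ofReal_natCast]
    _ ≤ _ := by
        apply ENNReal.ofReal_le_ofReal
        refine mul_le_mul_of_nonneg_right ?_ (mul_nonneg (by positivity) (hQ0 _))
        push_cast
        linarith [Nat.floor_le hT]

/-- Orbits that obey the lower bounds and are infinitely often at most doubly exponential in the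
time form a set of dimension at most one. -/
theorem dimH_lower_bounded_le_one {lam : ℕ → ℂ} {a : ℕ → ℝ} (hlam : ∀ n, lam (n + 1) ≠ 0)
    (ha : ∀ n, 4 ≤ a n) (hSG : SuperGeometric a) {C : ℝ} (hC : 1 ≤ C) :
    dimH {w | (∀ k, a k ≤ ‖expIter lam k w‖) ∧
      ∃ᶠ n : ℕ in atTop, ‖expIter lam n w‖ ≤ Real.exp (C ^ n)} ≤ 1 := by
  have ha0 : ∀ n, 0 < a n := fun n => by linarith [ha n]
  set U := fun R : ℕ => {w | ‖w‖ ≤ R ∧ (∀ k, a k ≤ ‖expIter lam k w‖) ∧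
      ∃ᶠ n : ℕ in atTop, ‖expIter lam n w‖ ≤ Real.exp (C ^ n)} with hU
  suffices h : ∀ R : ℕ, ∀ s : ℝ, 1 < s → MeasureTheory.Measure.hausdorffMeasure s (U R) = 0 by
    have hsub : {w | (∀ k, a k ≤ ‖expIter lam k w‖) ∧
      ∃ᶠ n : ℕ in atTop, ‖expIter lam n w‖ ≤ Real.exp (C ^ n)} ⊆ ⋃ R, U R := fun w hw =>
      Set.mem_iUnion.2 ⟨⌈‖w‖⌉₊, Nat.le_ceil _, hw⟩
    refine (dimH_mono hsub).trans ?_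
    rw [dimH_iUnion]
    refine iSup_le fun R => dimH_le fun d hd => ?_
    by_contra! hlt
    rw [h R d (by exact_mod_cast hlt)] at hd
    exact ENNReal.zero_ne_top hd
  intro R s hs
  apply hausdorffMeasure_eq_zero_of_content (by linarith)
  obtain ⟨K, hK0, hK⟩ := exists_tsum_progression_le hs
  set V : ℕ → Set ℂ := fun n => {w | ‖w‖ ≤ R ∧ (∀ k, a k ≤ ‖expIter lam k w‖) ∧
        ‖expIter lam (n + 1) w‖ ≤ Real.exp (C ^ (n + 1))} with hV
  set ε := (s - 1) / 2 with hε
  have hε0 : 0 < ε := by rw [hε]; linarith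
  have hsub : U R ⊆ limsup V atTop := by
    rintro w ⟨hw, hwa, hwf⟩
    rw [mem_limsup_iff_frequently_mem]
    rw [← map_add_atTop_eq_nat 1, frequently_map] at hwf
    exact hwf.mono fun n hn => ⟨hw, hwa, hn⟩
  -- The factor C in `G` absorbs the number of columns, the factor 2 leaves a summable (1/2)^(n+1).
  obtain ⟨B, hB0, hB⟩ := hSG.exists_prod_rpow_le ha0
    (G := 2 * C * (2 ^ s * (K * (2⁻¹ : ℝ) ^ (-ε)))) (by positivity) hε0
  have hbound : ∀ n, hausdorffContent s (V n) ≤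
      ENNReal.ofReal (3 * (2 * ((R : ℝ) + 1)) ^ s * B * (1 / 2) ^ (n + 1)) := by
    intro n
    refine (content_bounded_at_le hs hK0 (Nat.cast_nonneg R) (by positivity) hlam ha hK n).trans
      (ENNReal.ofReal_le_ofReal ?_)
    have h1 : C ^ (n + 1) + 2 ≤ 3 * C ^ (n + 1) := by
      have := one_le_pow₀ hC (n := n + 1); linarith
    have h2 : C ^ (n + 1) * ∏ i ∈ Finset.range (n + 1), (2 ^ s * (K * (a i / 2) ^ (-ε))) =
        (1 / 2) ^ (n + 1) * ∏ i ∈ Finset.range (n + 1),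
          (2 * C * (2 ^ s * (K * (2⁻¹ : ℝ) ^ (-ε))) * a i ^ (-ε)) := by
      rw [← Finset.card_range (n + 1), ← Finset.prod_const, ← Finset.prod_const,
        Finset.card_range, ← Finset.prod_mul_distrib, ← Finset.prod_mul_distrib]
      refine Finset.prod_congr rfl fun i _ => ?_
      rw [div_eq_mul_inv (a i), Real.mul_rpow (ha0 i).le (by norm_num)]
      ring
    have h3 : 0 ≤ ∏ i ∈ Finset.range (n + 1), (2 ^ s * (K * (a i / 2) ^ (-ε))) :=
      Finset.prod_nonneg fun i _ => by have := ha0 i; positivity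
    calc _ ≤ 3 * C ^ (n + 1) * ((2 * ((R : ℝ) + 1)) ^ s *
            ∏ i ∈ Finset.range (n + 1), (2 ^ s * (K * (a i / 2) ^ (-ε)))) := by gcongr
      _ = 3 * (2 * ((R : ℝ) + 1)) ^ s *
            (C ^ (n + 1) * ∏ i ∈ Finset.range (n + 1), (2 ^ s * (K * (a i / 2) ^ (-ε)))) := by ring
      _ ≤ 3 * (2 * ((R : ℝ) + 1)) ^ s * ((1 / 2) ^ (n + 1) * B) := by
          rw [h2]
          gcongr
          exact hB (n + 1)
      _ = _ := by ring
  refine MeasureTheory.measure_mono_null hsub (MeasureTheory.measure_limsup_atTop_eq_zero ?_)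
  refine ne_top_of_le_ne_top ?_ (ENNReal.tsum_le_tsum hbound)
  apply Summable.tsum_ofReal_ne_top
  exact Summable.mul_left _ ((summable_nat_add_iff 1).2
    (summable_geometric_of_lt_one (by norm_num) (by norm_num)))

/-! ### Invariance of dimension under preimages -/

theorem dimH_image_log_le {A : Set ℂ} (hA : A ⊆ Complex.slitPlane) (c μ : ℂ) :
    dimH ((fun w => Complex.log (w / μ) + c) '' {w | w / μ ∈ A}) ≤ dimH {w | w / μ ∈ A} := by
  refine dimH_image_le_of_locally_lipschitzOn fun w hw => ?_
  have h1 : HasStrictDerivAt (fun w : ℂ => w / μ) (1 / μ) w := (hasStrictDerivAt_id w).div_const μ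
  have h2 := ((Complex.hasStrictDerivAt_log (hA hw)).comp w h1).add_const c
  obtain ⟨K, t, ht, hK⟩ := h2.hasStrictFDerivAt.exists_lipschitzOnWith
  exact ⟨K, t, mem_nhdsWithin_of_mem_nhds ht, hK⟩

/-- The preimage is a countable union of images under branches of the logarithm, which are locally
Lipschitz. Two opposite slits are used so that the slit planes cover all nonzero values. -/
theorem dimH_preimage_expMap_le {μ : ℂ} (hμ : μ ≠ 0) (A : Set ℂ) :
    dimH (expMap μ ⁻¹' A) ≤ dimH A := by
  set S := Complex.slitPlane with hS
  set f : ℂ → ℤ → ℂ → ℂ := fun ν k w => Complex.log (w / ν) +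
    (Complex.log (ν / μ) + k * (2 * Real.pi * Complex.I)) with hf
  -- This is A off the slit, phrased through w / ν to fit `dimH_image_log_le`.
  set B : ℂ → Set ℂ := fun ν => {w | w / ν ∈ (fun w => w / ν) '' A ∩ S} with hB
  have hBA : ∀ ν, ν ≠ 0 → B ν ⊆ A := by
    rintro ν hν w ⟨⟨v, hv, hvw⟩, -⟩
    rwa [← (div_left_inj' hν).1 hvw]
  have hf' : ∀ ν, ν ≠ 0 → ∀ k, dimH (f ν k '' B ν) ≤ dimH A := fun ν hν k =>
    (dimH_image_log_le Set.inter_subset_right _ ν).trans (dimH_mono (hBA ν hν))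
  have hsub : expMap μ ⁻¹' A ⊆ (⋃ k, f μ k '' B μ) ∪ ⋃ k, f (-μ) k '' B (-μ) := by
    intro z hz
    have main : ∀ ν, ν ≠ 0 → expMap μ z / ν ∈ S → z ∈ ⋃ k, f ν k '' B ν := by
      intro ν hν h
      have hexp : Complex.exp z =
          Complex.exp (Complex.log (expMap μ z / ν) + Complex.log (ν / μ)) := by
        rw [Complex.exp_add, Complex.exp_log (Complex.slitPlane_ne_zero h),
          Complex.exp_log (div_ne_zero hν hμ), expMap]
        field_simp
      obtain ⟨k, hk⟩ := Complex.exp_eq_exp_iff_exists_int.1 hexp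
      exact Set.mem_iUnion.2 ⟨k, expMap μ z, ⟨⟨_, hz, rfl⟩, h⟩, by
        simp only [hf]; rw [← add_assoc, ← hk]⟩
    have hne : expMap μ z / μ ≠ 0 := by
      rw [expMap, mul_div_cancel_left₀ _ hμ]; exact Complex.exp_ne_zero z
    by_cases h : expMap μ z / μ ∈ S
    · exact Or.inl (main μ hμ h)
    · refine Or.inr (main (-μ) (neg_ne_zero.2 hμ) ?_)
      rw [div_neg]
      rw [hS, Complex.mem_slitPlane_iff] at h ⊢
      push Not at h
      refine Or.inl ?_
      rw [Complex.neg_re, Left.neg_pos_iff]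
      refine lt_of_le_of_ne h.1 fun h0 => hne (Complex.ext h0 h.2)
  refine (dimH_mono hsub).trans ?_
  rw [dimH_union, dimH_iUnion, dimH_iUnion]
  exact max_le (iSup_le (hf' _ hμ)) (iSup_le (hf' _ (neg_ne_zero.2 hμ)))

theorem dimH_le_preimage_expMap {μ : ℂ} (hμ : μ ≠ 0) (A : Set ℂ) :
    dimH A ≤ dimH (expMap μ ⁻¹' A) := by
  have hsub : A ⊆ expMap μ '' (expMap μ ⁻¹' A) ∪ {0} := by
    intro w hw
    by_cases h0 : w = 0
    · exact Or.inr h0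
    · have : expMap μ (Complex.log (w / μ)) = w := by
        rw [expMap, Complex.exp_log (div_ne_zero h0 hμ), mul_div_cancel₀ _ hμ]
      exact Or.inl ⟨Complex.log (w / μ), by rwa [Set.mem_preimage, this], this⟩
  refine (dimH_mono hsub).trans ?_
  rw [dimH_union, dimH_singleton]
  refine max_le (ContDiffOn.dimH_image_le (t := expMap μ ⁻¹' A) (s := Set.univ) ?_ convex_univ
    (Set.subset_univ _)) bot_le
  exact (contDiff_const.mul Complex.contDiff_exp).contDiffOn

theorem dimH_preimage_expIter {lam : ℕ → ℂ} (hlam : ∀ n, lam (n + 1) ≠ 0) (n : ℕ) (A : Set ℂ) :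
    dimH (expIter lam n ⁻¹' A) = dimH A := by
  induction n generalizing A with
  | zero => rfl
  | succ n ih =>
    change dimH (expIter lam n ⁻¹' (expMap (lam (n + 1)) ⁻¹' A)) = _
    rw [ih]
    exact le_antisymm (dimH_preimage_expMap_le (hlam n) A) (dimH_le_preimage_expMap (hlam n) A)

theorem expIter_shift (lam : ℕ → ℂ) (N k : ℕ) (z : ℂ) :
    expIter (fun i => lam (N + i)) k (expIter lam N z) = expIter lam (N + k) z := by
  induction k with
  | zero => rfl
  | succ k ih => rw [expIter_succ, ih]; rfl

theorem continuous_expIter (lam : ℕ → ℂ) (n : ℕ) : Continuous (expIter lam n) := by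
  induction n with
  | zero => exact continuous_id
  | succ n ih => exact (continuous_const.mul Complex.continuous_exp).comp ih

/-! ### Lower bound: boxes in annuli -/

/-- A vertical strip crosses an annulus in a box whose height is comparable with the radius. The
bottom of the box can be prescribed modulo `2 * π`. -/
theorem exists_box_in_annulus {δ a α : ℝ} (θ : ℝ) (hδ : 0 < δ) (hδ1 : δ ≤ 1)
    (ha : 64 * Real.pi / δ ≤ a) (hα : |α| + δ ≤ a) :
    ∃ (y : ℝ) (m : ℕ) (i : ℤ), 0 < y ∧ 1 ≤ m ∧ δ / (32 * Real.pi) * a ≤ m ∧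
      y = i * (2 * Real.pi) - θ ∧
      ∀ x v : ℝ, α ≤ x → x ≤ α + δ → y ≤ v → v ≤ y + 2 * Real.pi * m →
        a ≤ ‖(⟨x, v⟩ : ℂ)‖ ∧ ‖(⟨x, v⟩ : ℂ)‖ ≤ a * Real.exp δ := by
  have hπ := Real.pi_gt_three
  have ha' : 64 * Real.pi ≤ a * δ := by rwa [div_le_iff₀ hδ] at ha
  have ha96 : 96 ≤ a := by nlinarith
  have hα0 := abs_nonneg α
  have hsq : α ^ 2 = |α| ^ 2 := (sq_abs α).symm
  have hexp1 : 1 + δ ≤ Real.exp δ := by linarith [Real.add_one_le_exp δ]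
  have hexp2 : Real.exp δ ≤ 3 :=
    (Real.exp_le_exp.2 hδ1).trans (Real.exp_one_lt_d9.le.trans (by norm_num))
  set b := a * Real.exp δ with hb
  have hba : a * (1 + δ) ≤ b := by rw [hb]; gcongr
  have hb3 : b ≤ 3 * a := by rw [hb]; nlinarith
  have hbsq : a ^ 2 + 2 * δ * a ^ 2 ≤ b ^ 2 := by nlinarith [mul_nonneg hδ.le hδ.le, sq_nonneg a]
  -- On the strip, x² differs from α² by at most 2δa, so L ≤ v² ≤ H places x + iv in the annulus.
  set L := a ^ 2 - α ^ 2 + 2 * δ * a with hL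
  set H := b ^ 2 - α ^ 2 - 2 * δ * a with hH
  have hL0 : 0 < L := by rw [hL, hsq]; nlinarith
  have hHL : L + δ * a ^ 2 ≤ H := by rw [hL, hH]; nlinarith [mul_pos hδ (by linarith : 0 < a)]
  have hH0 : 0 ≤ H := by nlinarith [mul_pos hδ (by positivity : 0 < a ^ 2)]
  have hLs := Real.sq_sqrt hL0.le
  have hHs := Real.sq_sqrt hH0
  have hLp := Real.sqrt_pos.2 hL0
  have hHn := Real.sqrt_nonneg H
  have hHb : √H ≤ 3 * a := by
    refine (Real.sqrt_le_sqrt (by nlinarith : H ≤ b ^ 2)).trans ?_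
    rw [Real.sqrt_sq (by positivity)]; exact hb3
  have hLH : √L ≤ √H := Real.sqrt_le_sqrt (by nlinarith [mul_pos hδ (by positivity : 0 < a ^ 2)])
  have hgap : δ * a / 8 ≤ √H - √L := by
    have h1 : δ * a * a ≤ (√H - √L) * (√H + √L) := by nlinarith
    have h2 : (√H - √L) * (√H + √L) ≤ (√H - √L) * (8 * a) := by
      apply mul_le_mul_of_nonneg_left <;> linarith
    have h3 : 0 < a := by linarith
    nlinarith
  set i := ⌈(√L + θ) / (2 * Real.pi)⌉ with hi
  set y := i * (2 * Real.pi) - θ with hy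
  have hy1 : √L ≤ y := by
    have := Int.le_ceil ((√L + θ) / (2 * Real.pi))
    rw [div_le_iff₀ Real.two_pi_pos] at this
    linarith
  have hy2 : y ≤ √L + 2 * Real.pi := by
    have := (Int.ceil_lt_add_one ((√L + θ) / (2 * Real.pi))).le
    rw [← sub_le_iff_le_add, le_div_iff₀ Real.two_pi_pos] at this
    linarith
  have hπ0 : 0 < 2 * Real.pi := Real.two_pi_pos
  set X := (√H - y) / (2 * Real.pi) with hX
  -- The gap δa/8, less 2π for rounding y, is at least δa/16 + 2π exactly when δa ≥ 64π. The extra 1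
  -- pays for the floor.
  have hX1 : δ / (32 * Real.pi) * a + 1 ≤ X := by
    rw [hX, le_div_iff₀ hπ0]
    have : (δ / (32 * Real.pi) * a + 1) * (2 * Real.pi) = δ * a / 16 + 2 * Real.pi := by
      field_simp; ring
    rw [this]
    linarith
  have hpos : 0 < δ / (32 * Real.pi) * a := by positivity
  have hm : X < ⌊X⌋₊ + 1 := Nat.lt_floor_add_one X
  have hm' : (⌊X⌋₊ : ℝ) ≤ X := Nat.floor_le (by linarith)
  refine ⟨y, ⌊X⌋₊, i, by linarith, ?_, by linarith, rfl, fun x v hx1 hx2 hv1 hv2 => ?_⟩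
  · exact Nat.le_floor (by push_cast; linarith)
  · have hvH : v ≤ √H := by
      have : 2 * Real.pi * ⌊X⌋₊ ≤ 2 * Real.pi * X := by gcongr
      have h2 : 2 * Real.pi * X = √H - y := by rw [hX]; field_simp
      linarith
    have hvL : √L ≤ v := hy1.trans hv1
    have hxabs : |x ^ 2 - α ^ 2| ≤ 2 * δ * a := by
      have h1 : |x - α| ≤ δ := abs_le.2 ⟨by linarith, by linarith⟩
      have h2 : |x + α| ≤ 2 * a := by
        have := abs_add_le (x - α) (2 * α)
        rw [abs_mul, abs_two] at this
        have e : x - α + 2 * α = x + α := by ring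
        rw [e] at this
        linarith
      have : x ^ 2 - α ^ 2 = (x - α) * (x + α) := by ring
      rw [this, abs_mul]
      calc |x - α| * |x + α| ≤ δ * (2 * a) := by gcongr
        _ = _ := by ring
    rw [abs_le] at hxabs
    have hvs1 : L ≤ v ^ 2 := by rw [← hLs]; gcongr
    have hvs2 : v ^ 2 ≤ H := by rw [← hHs]; gcongr; linarith
    have hn : ‖(⟨x, v⟩ : ℂ)‖ = √(x ^ 2 + v ^ 2) := by
      rw [Complex.norm_def, Complex.normSq_mk, sq, sq]
    rw [hn]
    constructor
    · exact Real.le_sqrt_of_sq_le (by linarith)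
    · rw [Real.sqrt_le_left (by positivity)]
      linarith

/-! ### Mixed radix expansions and separated codings -/

/-- The remainders of the mixed radix expansion of `x` with respect to the bases `m`. -/
noncomputable def radixTail (m : ℕ → ℕ) (x : ℝ) : ℕ → ℝ
  | 0 => x
  | n + 1 => Int.fract (m n * radixTail m x n)

/-- The digits of the mixed radix expansion of `x` with respect to the bases `m`. -/
noncomputable def radixDigit (m : ℕ → ℕ) (x : ℝ) (n : ℕ) : ℕ := ⌊m n * radixTail m x n⌋₊

theorem radixTail_mem (m : ℕ → ℕ) {x : ℝ} (hx : x ∈ Set.Ico (0 : ℝ) 1) (n : ℕ) :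
    radixTail m x n ∈ Set.Ico (0 : ℝ) 1 := by
  cases n with
  | zero => exact hx
  | succ n => exact ⟨Int.fract_nonneg _, Int.fract_lt_one _⟩

theorem radixDigit_lt {m : ℕ → ℕ} (hm : ∀ n, 1 ≤ m n) {x : ℝ} (hx : x ∈ Set.Ico (0 : ℝ) 1) (n : ℕ) :
    radixDigit m x n < m n := by
  have h := radixTail_mem m hx n
  have h1 : (1 : ℝ) ≤ m n := by exact_mod_cast hm n
  rw [radixDigit, Nat.floor_lt (mul_nonneg (Nat.cast_nonneg _) h.1)]
  nlinarith [h.2]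

theorem mul_radixTail (m : ℕ → ℕ) {x : ℝ} (hx : x ∈ Set.Ico (0 : ℝ) 1) (n : ℕ) :
    m n * radixTail m x n = radixDigit m x n + radixTail m x (n + 1) := by
  have h : 0 ≤ m n * radixTail m x n :=
    mul_nonneg (Nat.cast_nonneg _) (radixTail_mem m hx n).1
  rw [radixDigit, radixTail, natCast_floor_eq_intCast_floor h, Int.floor_add_fract]

theorem prod_mul_sub_of_digits_eq (m : ℕ → ℕ) {x x' : ℝ} (hx : x ∈ Set.Ico (0 : ℝ) 1)
    (hx' : x' ∈ Set.Ico (0 : ℝ) 1) {n : ℕ} (h : ∀ i < n, radixDigit m x i = radixDigit m x' i) :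
    (∏ i ∈ Finset.range n, (m i : ℝ)) * (x - x') = radixTail m x n - radixTail m x' n := by
  induction n with
  | zero => simp [radixTail]
  | succ n ih =>
    rw [Finset.prod_range_succ, mul_right_comm, ih fun i hi => h i (by omega), sub_mul,
      mul_comm _ (m n : ℝ), mul_comm _ (m n : ℝ), mul_radixTail m hx, mul_radixTail m hx',
      h n (by omega)]
    ring

theorem prod_mul_abs_sub_le (m : ℕ → ℕ) {x x' : ℝ} (hx : x ∈ Set.Ico (0 : ℝ) 1)
    (hx' : x' ∈ Set.Ico (0 : ℝ) 1) {n : ℕ} (h : ∀ i < n, radixDigit m x i = radixDigit m x' i) :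
    (∏ i ∈ Finset.range (n + 1), (m i : ℝ)) * |x - x'| ≤
      |(radixDigit m x n : ℝ) - radixDigit m x' n| + 1 := by
  have h1 : (∏ i ∈ Finset.range (n + 1), (m i : ℝ)) * (x - x') =
      (radixDigit m x n - radixDigit m x' n) +
        (radixTail m x (n + 1) - radixTail m x' (n + 1)) := by
    rw [Finset.prod_range_succ, mul_right_comm, prod_mul_sub_of_digits_eq m hx hx' h, sub_mul,
      mul_comm _ (m n : ℝ), mul_comm _ (m n : ℝ), mul_radixTail m hx, mul_radixTail m hx']
    ring
  have h0 : 0 ≤ ∏ i ∈ Finset.range (n + 1), (m i : ℝ) :=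
    Finset.prod_nonneg fun i _ => Nat.cast_nonneg _
  rw [← abs_of_nonneg h0, ← abs_mul, h1]
  refine (abs_add_le _ _).trans ?_
  gcongr
  have h2 := radixTail_mem m hx (n + 1)
  have h3 := radixTail_mem m hx' (n + 1)
  rw [abs_le]
  constructor <;> linarith [h2.1, h2.2, h3.1, h3.2]

/-- If all digits agreed, |x - x'| times the product of the bases would stay at most 1, but that
product outgrows 2^n up to a constant. -/
theorem exists_first_radixDigit_ne {m : ℕ → ℕ} {a : ℕ → ℝ} {c : ℝ} (hc : 0 < c)
    (ha : ∀ n, 1 ≤ a n) (hm : ∀ n, c * a n ≤ m n) (hSG : SuperGeometric a) {x x' : ℝ}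
    (hx : x ∈ Set.Ico (0 : ℝ) 1) (hx' : x' ∈ Set.Ico (0 : ℝ) 1) (hne : x ≠ x') :
    ∃ n, radixDigit m x n ≠ radixDigit m x' n ∧
      ∀ i < n, radixDigit m x i = radixDigit m x' i := by
  classical
  by_cases h : ∃ n, radixDigit m x n ≠ radixDigit m x' n
  · exact ⟨Nat.find h, Nat.find_spec h, fun i hi => not_not.1 (Nat.find_min h hi)⟩
  exfalso
  push Not at h
  obtain ⟨C, hC, hle⟩ := hSG (2 / c) (by positivity)
  have hd : 0 < |x - x'| := abs_pos.2 (sub_ne_zero.2 hne)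
  have hbd : ∀ n : ℕ, (2 : ℝ) ^ n ≤ C / |x - x'| := by
    intro n
    have h1 := prod_mul_sub_of_digits_eq m hx hx' (n := n) fun i _ => h i
    have h2 := radixTail_mem m hx n
    have h3 := radixTail_mem m hx' n
    have h0 : 0 ≤ ∏ i ∈ Finset.range n, (m i : ℝ) :=
      Finset.prod_nonneg fun i _ => Nat.cast_nonneg _
    have h4 : (∏ i ∈ Finset.range n, (m i : ℝ)) * |x - x'| ≤ 1 := by
      rw [← abs_of_nonneg h0, ← abs_mul, h1, abs_le]
      constructor <;> linarith [h2.1, h2.2, h3.1, h3.2]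
    have h5 : c ^ n * ∏ i ∈ Finset.range n, a i ≤ ∏ i ∈ Finset.range n, (m i : ℝ) := by
      have : c ^ n * ∏ i ∈ Finset.range n, a i = ∏ i ∈ Finset.range n, (c * a i) := by
        rw [Finset.prod_mul_distrib, Finset.prod_const, Finset.card_range]
      rw [this]
      exact Finset.prod_le_prod (fun i _ => mul_nonneg hc.le (by linarith [ha i])) fun i _ => hm i
    rw [le_div_iff₀ hd]
    have h6 := hle n
    rw [div_pow, div_le_iff₀ (by positivity)] at h6
    calc (2 : ℝ) ^ n * |x - x'| ≤ (C * ∏ i ∈ Finset.range n, (m i : ℝ)) * |x - x'| := by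
          gcongr
          refine h6.trans ?_
          rw [mul_assoc, mul_comm _ (c ^ n)]
          gcongr
      _ = C * ((∏ i ∈ Finset.range n, (m i : ℝ)) * |x - x'|) := by ring
      _ ≤ C := by nlinarith
  obtain ⟨n, hn⟩ := pow_unbounded_of_one_lt (C / |x - x'|) (one_lt_two (α := ℝ))
  exact absurd (hbd n) (not_le.2 hn)

/-- A set that contains points coded by all digit sequences, with enough separation between points
of different codes, has dimension at least one. -/
theorem one_le_dimH_of_separated_coding {X : Set ℂ} {m : ℕ → ℕ} {a : ℕ → ℝ} {c M : ℝ}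
    (hc : 0 < c) (hM : 1 ≤ M) (ha : ∀ n, 1 ≤ a n) (hm1 : ∀ n, 1 ≤ m n)
    (hm : ∀ n, c * a n ≤ m n) (hSG : SuperGeometric a) (Z : (ℕ → ℕ) → ℂ)
    (hZ : ∀ d : ℕ → ℕ, (∀ n, d n < m n) → Z d ∈ X)
    (hsep : ∀ d d' : ℕ → ℕ, (∀ n, d n < m n) → (∀ n, d' n < m n) → ∀ n,
      |(d n : ℝ) - d' n| ≤ (∏ i ∈ Finset.range n, (M * a (i + 1))) * ‖Z d - Z d'‖) :
    1 ≤ dimH X := by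
  have ha0 : ∀ n, 0 < a n := fun n => by linarith [ha n]
  have hM0 : 0 < M := by linarith
  set z : ℝ → ℂ := fun x => Z (radixDigit m x) with hz
  -- The inverse of the coding x ↦ z x is τ-Hölder.
  have main : ∀ τ : ℝ, 0 < τ → τ < 1 → ∃ C : ℝ, 0 < C ∧ ∀ x ∈ Set.Ico (0 : ℝ) 1,
      ∀ x' ∈ Set.Ico (0 : ℝ) 1, |x - x'| ≤ C * ‖z x - z x'‖ ^ τ := by
    intro τ hτ hτ1
    obtain ⟨B, hB, hle⟩ := hSG.exists_prod_rpow_le ha0 (G := M ^ τ * c⁻¹) (ε := 1 - τ)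
      (by positivity) (by linarith)
    refine ⟨2 * (M / c) ^ τ * B, by positivity, fun x hx x' hx' => ?_⟩
    by_cases hne : x = x'
    · rw [hne, sub_self, abs_zero]; positivity
    obtain ⟨n, hn, hlt⟩ := exists_first_radixDigit_ne hc ha hm hSG hx hx' hne
    have hk := radixDigit_lt hm1 hx
    have hk' := radixDigit_lt hm1 hx'
    have h1 := prod_mul_abs_sub_le m hx hx' hlt
    have h2 := hsep _ _ hk hk' n
    set K := |(radixDigit m x n : ℝ) - radixDigit m x' n| with hK
    have hK1 : 1 ≤ K := by
      have : (1 : ℤ) ≤ |(radixDigit m x n : ℤ) - radixDigit m x' n| :=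
        Int.one_le_abs (sub_ne_zero.2 (by exact_mod_cast hn))
      rw [hK]
      exact_mod_cast this
    have hKm : K ≤ m n := by
      have e1 : (radixDigit m x n : ℝ) ≤ m n := by exact_mod_cast (hk n).le
      have e2 : (radixDigit m x' n : ℝ) ≤ m n := by exact_mod_cast (hk' n).le
      have e3 : (0 : ℝ) ≤ radixDigit m x n := Nat.cast_nonneg _
      have e4 : (0 : ℝ) ≤ radixDigit m x' n := Nat.cast_nonneg _
      rw [hK, abs_le]
      constructor <;> linarith
    set Y := ‖z x - z x'‖ with hY
    have hY0 : 0 ≤ Y := norm_nonneg _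
    have hmn : (0 : ℝ) < m n := by exact_mod_cast hm1 n
    have hca : ∀ i, 0 < c * a i := fun i => mul_pos hc (ha0 i)
    have hP : 0 < ∏ i ∈ Finset.range n, (c * a i) := Finset.prod_pos fun i _ => hca i
    have hPm : ∏ i ∈ Finset.range n, (c * a i) ≤ ∏ i ∈ Finset.range n, (m i : ℝ) :=
      Finset.prod_le_prod (fun i _ => (hca i).le) fun i _ => hm i
    have hQ : 0 ≤ ∏ i ∈ Finset.range n, (M * a i) :=
      Finset.prod_nonneg fun i _ => by have := ha0 i; positivity
    have h3 : K ≤ (∏ i ∈ Finset.range n, (M * a i)) * (M * a n) * Y := by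
      refine h2.trans ?_
      rw [← Finset.prod_range_succ (fun i => M * a i), Finset.prod_range_succ' (fun i => M * a i)]
      refine mul_le_mul_of_nonneg_right ?_ hY0
      refine le_mul_of_one_le_right (Finset.prod_nonneg fun i _ => ?_) ?_
      · have := ha0 (i + 1); positivity
      · nlinarith [ha 0]
    -- Since K / m_n ≤ 1, it may be replaced by its τ-th power before the separation estimate is
    -- used.
    have h4 : K / m n ≤ (M / c * ((∏ i ∈ Finset.range n, (M * a i)) * Y)) ^ τ := by
      have e0 : 0 ≤ K / m n := by positivity
      have e1 : K / m n ≤ 1 := (div_le_one hmn).2 hKm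
      have e2 : K / m n ≤ (K / m n) ^ τ := by
        simpa using Real.rpow_le_rpow_of_exponent_ge' e0 e1 hτ.le hτ1.le
      refine e2.trans (Real.rpow_le_rpow e0 ?_ hτ.le)
      calc K / m n ≤ K / (c * a n) := by gcongr; exacts [hca n, hm n]
        _ ≤ ((∏ i ∈ Finset.range n, (M * a i)) * (M * a n) * Y) / (c * a n) := by
            gcongr; exact (hca n).le
        _ = _ := by have := (ha0 n).ne'; field_simp
    have h5 : (∏ i ∈ Finset.range n, (M * a i)) ^ τ * (∏ i ∈ Finset.range n, (c * a i))⁻¹ ≤ B := by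
      refine le_trans (le_of_eq ?_) (hle n)
      rw [← Real.finsetProd_rpow _ _ (fun i _ => by have := ha0 i; positivity),
        ← Finset.prod_inv_distrib, ← Finset.prod_mul_distrib]
      refine Finset.prod_congr rfl fun i _ => ?_
      rw [Real.mul_rpow hM0.le (ha0 i).le, mul_inv, neg_sub, Real.rpow_sub_one (ha0 i).ne']
      ring
    rw [Finset.prod_range_succ] at h1
    have h6 : |x - x'| ≤ 2 * (K / m n) * (∏ i ∈ Finset.range n, (c * a i))⁻¹ := by
      have e1 : (∏ i ∈ Finset.range n, (c * a i)) * m n * |x - x'| ≤ 2 * K := by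
        calc _ ≤ (∏ i ∈ Finset.range n, (m i : ℝ)) * m n * |x - x'| := by gcongr
          _ ≤ K + 1 := h1
          _ ≤ 2 * K := by linarith
      have e2 : 2 * (K / m n) * (∏ i ∈ Finset.range n, (c * a i))⁻¹ =
          2 * K / ((∏ i ∈ Finset.range n, (c * a i)) * m n) := by
        field_simp
      rw [e2, le_div_iff₀ (by positivity)]
      linarith
    calc |x - x'| ≤ 2 * (K / m n) * (∏ i ∈ Finset.range n, (c * a i))⁻¹ := h6
      _ ≤ 2 * (M / c * ((∏ i ∈ Finset.range n, (M * a i)) * Y)) ^ τ *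
            (∏ i ∈ Finset.range n, (c * a i))⁻¹ := by gcongr
      _ = 2 * (M / c) ^ τ * ((∏ i ∈ Finset.range n, (M * a i)) ^ τ *
            (∏ i ∈ Finset.range n, (c * a i))⁻¹) * Y ^ τ := by
          rw [Real.mul_rpow (by positivity) (by positivity), Real.mul_rpow hQ hY0]; ring
      _ ≤ _ := by gcongr
  have hzX : z '' Set.Ico (0 : ℝ) 1 ⊆ X := by
    rintro _ ⟨x, hx, rfl⟩
    exact hZ _ (radixDigit_lt hm1 hx)
  by_contra! hlt
  obtain ⟨t, ht1, ht2⟩ := ENNReal.lt_iff_exists_nnreal_btwn.1 hlt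
  have ht0 : 0 < t := ENNReal.coe_pos.1 (pos_of_gt ht1)
  have ht2' : t < 1 := by exact_mod_cast ht2
  obtain ⟨C, hC, hle⟩ := main t (by exact_mod_cast ht0) (by exact_mod_cast ht2')
  have hinj : Set.InjOn z (Set.Ico (0 : ℝ) 1) := by
    intro x hx x' hx' h
    have := hle x hx x' hx'
    rw [h, sub_self, norm_zero, Real.zero_rpow (by exact_mod_cast ht0.ne'), mul_zero] at this
    exact sub_eq_zero.1 (abs_nonpos_iff.1 this)
  set f := Function.invFunOn z (Set.Ico (0 : ℝ) 1) with hf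
  have hfz : ∀ x ∈ Set.Ico (0 : ℝ) 1, f (z x) = x := fun x hx => hinj.leftInvOn_invFunOn hx
  have hhol : HolderOnWith C.toNNReal t f (z '' Set.Ico (0 : ℝ) 1) := by
    rintro _ ⟨x, hx, rfl⟩ _ ⟨x', hx', rfl⟩
    rw [hfz x hx, hfz x' hx', edist_dist, edist_dist, Real.dist_eq, dist_eq_norm,
      ENNReal.ofReal_rpow_of_nonneg (norm_nonneg _) t.coe_nonneg]
    change _ ≤ ENNReal.ofReal C * _
    rw [← ENNReal.ofReal_mul hC.le]
    exact ENNReal.ofReal_le_ofReal (hle x hx x' hx')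
  have himg : f '' (z '' Set.Ico (0 : ℝ) 1) = Set.Ico (0 : ℝ) 1 := by
    rw [Set.image_image]
    exact (Set.image_congr hfz).trans (Set.image_id' _)
  have h1 := hhol.dimH_image_le ht0
  rw [himg, Real.dimH_of_nonempty_interior (by rw [interior_Ico]; exact Set.nonempty_Ioo.2 one_pos),
    Module.finrank_self, Nat.cast_one] at h1
  have h2 : (t : ENNReal) ≤ dimH (z '' Set.Ico (0 : ℝ) 1) := by
    rwa [ENNReal.le_div_iff_mul_le (Or.inl (by exact_mod_cast ht0.ne')) (Or.inl ENNReal.coe_ne_top),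
      one_mul] at h1
  exact absurd (h2.trans (dimH_mono hzX)) (not_le.2 ht1)

/-! ### Points with prescribed itineraries -/

/-- Half of a fundamental domain of the exponential map in a vertical strip. -/
def codingCell (α δ y : ℝ) (j : ℕ) : Set ℂ :=
  Set.Icc α (α + δ) ×ℂ Set.Icc (y + 2 * Real.pi * j) (y + 2 * Real.pi * j + Real.pi)

theorem isCompact_codingCell (α δ y : ℝ) (j : ℕ) : IsCompact (codingCell α δ y j) :=
  isCompact_Icc.reProdIm isCompact_Icc

/-- Since y ≡ -arg μ mod 2π, a half period maps onto arguments in [0, π]; thus the upper half of the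
annulus is covered. -/
theorem exists_mem_codingCell_expMap_eq {μ u : ℂ} {δ ρ y : ℝ} {i : ℤ} (hμ : μ ≠ 0) (hρ : 0 < ρ)
    (hy : y = i * (2 * Real.pi) - Complex.arg μ) (hu : 0 < u.im) (hu1 : ρ ≤ ‖u‖)
    (hu2 : ‖u‖ ≤ ρ * Real.exp δ) (j : ℕ) :
    ∃ z ∈ codingCell (Real.log (ρ / ‖μ‖)) δ y j, expMap μ z = u := by
  have hμ' : 0 < ‖μ‖ := norm_pos_iff.2 hμ
  have hu0 : u ≠ 0 := fun h => by simp [h] at hu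
  have hu' : 0 < ‖u‖ := norm_pos_iff.2 hu0
  have harg0 : 0 ≤ u.arg := Complex.arg_nonneg_iff.2 hu.le
  have hargπ := Complex.arg_le_pi u
  refine ⟨⟨Real.log (‖u‖ / ‖μ‖), y + 2 * Real.pi * j + u.arg⟩, ⟨⟨?_, ?_⟩, ⟨?_, ?_⟩⟩, ?_⟩
  · exact Real.log_le_log (by positivity) (by gcongr)
  · change Real.log (‖u‖ / ‖μ‖) ≤ _
    rw [← Real.log_exp δ]
    rw [← Real.log_mul (by positivity) (by positivity)]
    refine Real.log_le_log (by positivity) ?_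
    rw [div_mul_eq_mul_div]
    gcongr
  · change _ ≤ y + 2 * Real.pi * j + u.arg
    linarith
  · change y + 2 * Real.pi * j + u.arg ≤ _
    linarith
  · have hz : (⟨Real.log (‖u‖ / ‖μ‖), y + 2 * Real.pi * j + u.arg⟩ : ℂ) =
        Complex.log u - Complex.log μ + ((i + j : ℤ) : ℂ) * (2 * Real.pi * Complex.I) := by
      apply Complex.ext
      · simp [Complex.log_re, Real.log_div hu'.ne' hμ'.ne']
      · simp [Complex.log_im, hy]; ring
    rw [hz, expMap, Complex.exp_add, Complex.exp_int_mul_two_pi_mul_I, mul_one, Complex.exp_sub,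
      Complex.exp_log hu0, Complex.exp_log hμ, mul_div_cancel₀ _ hμ]

/-- Finite itineraries are realised by pulling points back, and Cantor's intersection theorem gives
the infinite one. -/
theorem exists_orbit_in_compacts {lam : ℕ → ℂ} {C : ℕ → Set ℂ} (hC : ∀ n, IsCompact (C n))
    (hne : ∀ n, (C n).Nonempty) (hsub : ∀ n, C (n + 1) ⊆ expMap (lam (n + 1)) '' C n) :
    ∃ w, ∀ n, expIter lam n w ∈ C n := by
  set S : ℕ → Set ℂ := fun n => {w | ∀ k ≤ n, expIter lam k w ∈ C k} with hS
  have hclosed : ∀ n, IsClosed (S n) := fun n => by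
    have : S n = ⋂ k, ⋂ (_ : k ≤ n), expIter lam k ⁻¹' C k := by ext w; simp [hS]
    rw [this]
    exact isClosed_iInter fun k => isClosed_iInter fun _ =>
      (hC k).isClosed.preimage (continuous_expIter lam k)
  have hreach : ∀ n, ∀ u ∈ C n, ∃ w ∈ S n, expIter lam n w = u := by
    intro n
    induction n with
    | zero =>
      intro u hu
      refine ⟨u, fun k hk => ?_, rfl⟩
      obtain rfl : k = 0 := by omega
      exact hu
    | succ n ih =>
      intro u hu
      obtain ⟨z, hz, rfl⟩ := hsub n hu
      obtain ⟨w, hw, rfl⟩ := ih z hz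
      refine ⟨w, fun k hk => ?_, rfl⟩
      rcases Nat.le_succ_iff.1 hk with h | rfl
      · exact hw k h
      · exact hu
  have hS0 : IsCompact (S 0) := (hC 0).of_isClosed_subset (hclosed 0) fun w hw => hw 0 le_rfl
  obtain ⟨w, hw⟩ := IsCompact.nonempty_iInter_of_sequence_nonempty_isCompact_isClosed S
    (fun n w hw k hk => hw k (by omega))
    (fun n => by obtain ⟨u, hu⟩ := hne n; obtain ⟨w, hw, -⟩ := hreach n u hu; exact ⟨w, hw⟩)
    hS0 hclosed
  exact ⟨w, fun n => Set.mem_iInter.1 hw n n le_rfl⟩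

theorem norm_expMap_sub_le {μ z z' : ℂ} {x : ℝ} (hz : z.re ≤ x) (hz' : z'.re ≤ x) :
    ‖expMap μ z - expMap μ z'‖ ≤ ‖μ‖ * Real.exp x * ‖z - z'‖ := by
  refine Convex.norm_image_sub_le_of_norm_hasDerivWithin_le (s := {w : ℂ | w.re ≤ x})
    (f' := fun w => μ * Complex.exp w)
    (fun w _ => ((Complex.hasDerivAt_exp w).const_mul μ).hasDerivWithinAt) (fun w hw => ?_)
    (convex_halfSpace_re_le x) hz' hz
  rw [norm_mul, Complex.norm_exp]
  gcongr
  exact hw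

theorem norm_expIter_sub_le {lam : ℕ → ℂ} {x : ℕ → ℝ} {w w' : ℂ}
    (hw : ∀ n, (expIter lam n w).re ≤ x n) (hw' : ∀ n, (expIter lam n w').re ≤ x n) (n : ℕ) :
    ‖expIter lam n w - expIter lam n w'‖ ≤
      (∏ i ∈ Finset.range n, (‖lam (i + 1)‖ * Real.exp (x i))) * ‖w - w'‖ := by
  induction n with
  | zero => simp [expIter]
  | succ n ih =>
    rw [expIter_succ, expIter_succ, Finset.prod_range_succ]
    refine (norm_expMap_sub_le (hw n) (hw' n)).trans ?_
    calc _ ≤ ‖lam (n + 1)‖ * Real.exp (x n) *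
          ((∏ i ∈ Finset.range n, (‖lam (i + 1)‖ * Real.exp (x i))) * ‖w - w'‖) := by gcongr
      _ = _ := by ring

/-- Half periods leave gaps of length π, so even adjacent cells are separated. -/
theorem abs_sub_le_of_mem_codingCell {α δ y : ℝ} {j j' : ℕ} {z z' : ℂ}
    (hz : z ∈ codingCell α δ y j) (hz' : z' ∈ codingCell α δ y j') :
    |(j : ℝ) - j'| ≤ ‖z - z'‖ := by
  refine le_trans ?_ (Complex.abs_im_le_norm _)
  obtain ⟨-, h1, h2⟩ := hz
  obtain ⟨-, h1', h2'⟩ := hz'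
  rw [Complex.sub_im]
  have hπ := Real.pi_gt_three
  rcases lt_trichotomy j j' with h | rfl | h
  · have : (j : ℝ) + 1 ≤ j' := by exact_mod_cast h
    rw [abs_sub_comm, abs_sub_comm z.im, abs_of_nonneg (by linarith)]
    exact le_trans (by nlinarith) (le_abs_self _)
  · simp
  · have : (j' : ℝ) + 1 ≤ j := by exact_mod_cast h
    rw [abs_of_nonneg (by linarith)]
    exact le_trans (by nlinarith) (le_abs_self _)

/-- Lower bound for the dimension when the annuli have fixed modulus. -/
theorem one_le_dimH_of_thin_annuli {lam : ℕ → ℂ} {a : ℕ → ℝ} {δ : ℝ}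
    (hlam : ∀ n, lam (n + 1) ≠ 0) (hδ : 0 < δ) (hδ1 : δ ≤ 1) (ha : ∀ n, 64 * Real.pi / δ ≤ a n)
    (hcross : ∀ n, |Real.log (a (n + 1) / ‖lam (n + 1)‖)| + δ ≤ a n) (hSG : SuperGeometric a) :
    1 ≤ dimH {w | ∀ n, a n ≤ ‖expIter lam n w‖ ∧ ‖expIter lam n w‖ ≤ a n * Real.exp δ} := by
  have hπ := Real.pi_gt_three
  have ha1 : ∀ n, 1 ≤ a n := fun n => le_trans (by rw [le_div_iff₀ hδ]; linarith) (ha n)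
  have ha0 : ∀ n, 0 < a n := fun n => by linarith [ha1 n]
  set α : ℕ → ℝ := fun n => Real.log (a (n + 1) / ‖lam (n + 1)‖) with hα
  choose y m i hy0 hm1 hm hyi hbox using fun n =>
    exists_box_in_annulus (Complex.arg (lam (n + 1))) hδ hδ1 (ha n) (hcross n)
  have hcell : ∀ n j, j < m n → ∀ z ∈ codingCell (α n) δ (y n) j,
      0 < z.im ∧ a n ≤ ‖z‖ ∧ ‖z‖ ≤ a n * Real.exp δ := by
    rintro n j hj z ⟨⟨h1, h2⟩, h3, h4⟩
    have hj' : (j : ℝ) + 1 ≤ m n := by exact_mod_cast hj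
    have hj0 : (0 : ℝ) ≤ 2 * Real.pi * j := by positivity
    have hy := hy0 n
    refine ⟨by linarith, hbox n z.re z.im h1 h2 (by linarith) ?_⟩
    nlinarith
  have hex : ∀ d : ℕ → ℕ, (∀ n, d n < m n) →
      ∃ w, ∀ n, expIter lam n w ∈ codingCell (α n) δ (y n) (d n) := by
    intro d hd
    refine exists_orbit_in_compacts (fun n => isCompact_codingCell _ _ _ _) (fun n => ?_)
      fun n u hu => ?_
    · refine ⟨⟨α n, y n + 2 * Real.pi * d n⟩, ⟨?_, ?_⟩, ?_, ?_⟩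
      · exact le_rfl
      · change α n ≤ α n + δ; linarith
      · exact le_rfl
      · change y n + 2 * Real.pi * d n ≤ y n + 2 * Real.pi * d n + Real.pi; linarith
    · obtain ⟨h1, h2, h3⟩ := hcell (n + 1) _ (hd (n + 1)) u hu
      exact exists_mem_codingCell_expMap_eq (hlam n) (ha0 (n + 1)) (hyi n) h1 h2 h3 (d n)
  classical
  choose! Z hZ using hex
  refine one_le_dimH_of_separated_coding (M := Real.exp δ) (c := δ / (32 * Real.pi)) (a := a)
    (by positivity) (Real.one_le_exp hδ.le) ha1 hm1 hm hSG Z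
    (fun d hd n => (hcell n _ (hd n) _ (hZ d hd n)).2) fun d d' hd hd' n => ?_
  refine (abs_sub_le_of_mem_codingCell (hZ d hd n) (hZ d' hd' n)).trans ?_
  refine (norm_expIter_sub_le (x := fun n => α n + δ) (fun n => (hZ d hd n).1.2)
    (fun n => (hZ d' hd' n).1.2) n).trans (le_of_eq ?_)
  congr 1
  refine Finset.prod_congr rfl fun k _ => ?_
  have hl : 0 < ‖lam (k + 1)‖ := norm_pos_iff.2 (hlam k)
  rw [Real.exp_add, hα, Real.exp_log (div_pos (ha0 _) hl)]
  field_simp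

/-! ### Crossing condition and passage to late times -/

theorem SuperGeometric.mono {a a' : ℕ → ℝ} (h : SuperGeometric a) (ha : ∀ n, 0 ≤ a n)
    (hle : ∀ n, a n ≤ a' n) : SuperGeometric a' := fun B hB => by
  obtain ⟨C, hC, hC'⟩ := h B hB
  refine ⟨C, hC, fun n => (hC' n).trans ?_⟩
  gcongr
  · exact fun i _ => ha i
  · exact hle _

/-- Lower bound for the dimension when the strips `log (a (n + 1)) ≤ re z + log ‖lam (n + 1)‖ ≤
log (b (n + 1))` cross the annuli `a n ≤ ‖z‖ ≤ b n` away from their vertical tangents. -/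
theorem one_le_dimH_of_crossing {lam : ℕ → ℂ} {a b : ℕ → ℝ} {δ q : ℝ}
    (hlam : ∀ n, lam (n + 1) ≠ 0) (hδ : 0 < δ) (hδ1 : δ ≤ 1) (hq0 : 0 < q) (hq : q < 1)
    (ha : ∀ n, 64 * Real.pi / δ ≤ a n) (haq : ∀ n, 2 / (1 - q) ≤ a n)
    (hab : ∀ n, a n * Real.exp δ ≤ b n)
    (hcross : ∀ n, a (n + 1) ≤ ‖lam (n + 1)‖ * Real.exp (q * a n) ∧
      ‖lam (n + 1)‖ * Real.exp (-(q * a n)) ≤ b (n + 1)) (hSG : SuperGeometric a) :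
    1 ≤ dimH {w | ∀ n, a n ≤ ‖expIter lam n w‖ ∧ ‖expIter lam n w‖ ≤ b n} := by
  have hπ := Real.pi_pos
  have ha0 : ∀ n, 0 < a n := fun n => lt_of_lt_of_le (by positivity) (ha n)
  -- Raising the inner radius only as far as needed keeps |log(a'_{n+1}/|λ_{n+1}|)| ≤ q a_n + δ;
  -- then (1 - q) a_n ≥ 2 ≥ 2δ gives the crossing.
  set a' : ℕ → ℝ := fun n => match n with
    | 0 => a 0
    | n + 1 => max (a (n + 1)) (‖lam (n + 1)‖ * Real.exp (-(q * a n) - δ)) with ha'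
  have haa' : ∀ n, a n ≤ a' n := by
    rintro (_ | n)
    · exact le_rfl
    · exact le_max_left _ _
  have hab' : ∀ n, a' n * Real.exp δ ≤ b n := by
    rintro (_ | n)
    · exact hab 0
    · change max _ _ * _ ≤ _
      rw [max_mul_of_nonneg _ _ (Real.exp_pos δ).le, mul_assoc, ← Real.exp_add, sub_add_cancel]
      exact max_le (hab _) (hcross n).2
  have hthin := one_le_dimH_of_thin_annuli (a := a') hlam hδ hδ1 (fun n => (ha n).trans (haa' n))
    (fun n => ?_) (hSG.mono (fun n => (ha0 n).le) haa')
  · refine hthin.trans (dimH_mono fun w hw n => ?_)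
    exact ⟨(haa' n).trans (hw n).1, (hw n).2.trans (hab' n)⟩
  · have hl : 0 < ‖lam (n + 1)‖ := norm_pos_iff.2 (hlam n)
    have h0 : 0 < a' (n + 1) := (ha0 (n + 1)).trans_le (haa' (n + 1))
    have hup : a' (n + 1) / ‖lam (n + 1)‖ ≤ Real.exp (q * a n + δ) := by
      rw [div_le_iff₀ hl, mul_comm]
      refine max_le ((hcross n).1.trans (by gcongr; linarith)) ?_
      have h1 : 0 ≤ q * a n := mul_nonneg hq0.le (ha0 n).le
      gcongr
      linarith
    have hlow : Real.exp (-(q * a n + δ)) ≤ a' (n + 1) / ‖lam (n + 1)‖ := by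
      rw [le_div_iff₀ hl, mul_comm, neg_add']
      exact le_max_right _ _
    have h1 := Real.log_le_log (by positivity) hup
    have h2 := Real.log_le_log (by positivity) hlow
    rw [Real.log_exp] at h1 h2
    have h3 : |Real.log (a' (n + 1) / ‖lam (n + 1)‖)| ≤ q * a n + δ := abs_le.2 ⟨h2, h1⟩
    have h4 := haq n
    rw [div_le_iff₀ (by linarith)] at h4
    linarith [haa' n]

theorem superGeometric_shift {a : ℕ → ℝ} (ha : ∀ n, 1 ≤ n → 0 < a n)
    (h : Tendsto (fun n : ℕ => (∏ i ∈ Finset.Icc 1 n, a i) ^ (1 / (n : ℝ))) atTop atTop) {N : ℕ}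
    (hN : 1 ≤ N) : SuperGeometric fun k => a (N + k) := by
  obtain ⟨M, rfl⟩ := Nat.exists_eq_add_of_le' hN
  intro B hB
  set P : ℕ → ℝ := fun n => ∏ i ∈ Finset.Icc 1 n, a i with hP
  have hP0 : ∀ n, 0 < P n := fun n =>
    Finset.prod_pos fun i hi => ha i (Finset.mem_Icc.1 hi).1
  have hsplit : ∀ k, P (M + k) = P M * ∏ i ∈ Finset.range k, a (M + 1 + i) := by
    intro k
    induction k with
    | zero => simp
    | succ k ih =>
      rw [Finset.prod_range_succ, ← mul_assoc, ← ih, hP]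
      simp only
      rw [← add_assoc, Finset.prod_Icc_succ_top (by omega), add_right_comm]
  have hQ0 : ∀ k, 0 < ∏ i ∈ Finset.range k, a (M + 1 + i) := fun k =>
    Finset.prod_pos fun i _ => ha _ (by omega)
  have hev : ∀ᶠ k in atTop, B ^ k / (∏ i ∈ Finset.range k, a (M + 1 + i)) ≤ P M := by
    have h1 := (tendsto_add_atTop_nat M).eventually (h.eventually_ge_atTop (max B 1))
    filter_upwards [h1, eventually_ge_atTop 1] with k hk hk1
    rw [div_le_iff₀ (hQ0 k), ← hsplit, add_comm M k]
    have hkM : ((k + M : ℕ) : ℝ) ≠ 0 := by positivity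
    calc B ^ k ≤ max B 1 ^ k := by gcongr; exact le_max_left _ _
      _ ≤ max B 1 ^ (k + M) := pow_le_pow_right₀ (le_max_right _ _) (by omega)
      _ ≤ (P (k + M) ^ (1 / ((k + M : ℕ) : ℝ))) ^ (k + M) := by
          gcongr
      _ = P (k + M) := by
          rw [← Real.rpow_natCast, ← Real.rpow_mul (hP0 _).le, one_div, inv_mul_cancel₀ hkM,
            Real.rpow_one]
  obtain ⟨C, hC⟩ := (isBoundedUnder_of_eventually_le hev).bddAbove_range
  refine ⟨max C 1, by positivity, fun k => ?_⟩
  rw [← div_le_iff₀ (hQ0 k)]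
  exact (hC ⟨k, rfl⟩).trans (le_max_left _ _)

/-- Orbits that eventually obey the lower bounds and are infinitely often at most doubly exponential
in the time form a set of dimension at most one. -/
theorem dimH_eventually_lower_bounded_le_one {lam : ℕ → ℂ} {a : ℕ → ℝ}
    (hlam : ∀ n, 1 ≤ n → lam n ≠ 0) (ha0 : ∀ n, 1 ≤ n → 0 < a n)
    (h : Tendsto (fun n : ℕ => (∏ i ∈ Finset.Icc 1 n, a i) ^ (1 / (n : ℝ))) atTop atTop)
    (ha : ∀ᶠ n in atTop, 4 ≤ a n) {C : ℝ} (hC : 1 ≤ C) :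
    dimH {z | (∀ᶠ n in atTop, a n ≤ ‖expIter lam n z‖) ∧
      ∃ᶠ n : ℕ in atTop, ‖expIter lam n z‖ ≤ Real.exp (C ^ n)} ≤ 1 := by
  obtain ⟨N₀, hN₀⟩ := eventually_atTop.1 ha
  set W : ℕ → Set ℂ := fun N => {w | (∀ k, a (N + k) ≤ ‖expIter (fun i => lam (N + i)) k w‖) ∧
      -- The new base works because k + N ≤ (N + 1)k for k ≥ 1.
      ∃ᶠ k : ℕ in atTop, ‖expIter (fun i => lam (N + i)) k w‖ ≤ Real.exp ((C ^ (N + 1)) ^ k)} with hW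
  have hsub : {z | (∀ᶠ n in atTop, a n ≤ ‖expIter lam n z‖) ∧
      ∃ᶠ n : ℕ in atTop, ‖expIter lam n z‖ ≤ Real.exp (C ^ n)} ⊆
      ⋃ N : ℕ, expIter lam (N₀ + 1 + N) ⁻¹' W (N₀ + 1 + N) := by
    rintro z ⟨hz, hf⟩
    obtain ⟨N, hN⟩ := eventually_atTop.1 hz
    refine Set.mem_iUnion.2 ⟨N, fun k => ?_, ?_⟩
    · rw [expIter_shift]
      exact hN _ (by omega)
    · simp only [expIter_shift]
      set N' := N₀ + 1 + N
      have h1 : ∃ᶠ k : ℕ in atTop, ‖expIter lam (k + N') z‖ ≤ Real.exp (C ^ (k + N')) := by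
        rwa [← map_add_atTop_eq_nat N', frequently_map] at hf
      refine (h1.and_eventually (eventually_ge_atTop 1)).mono fun k hk => ?_
      rw [add_comm N' k]
      refine hk.1.trans (Real.exp_le_exp.2 ?_)
      rw [← pow_mul]
      refine pow_le_pow_right₀ hC ?_
      nlinarith [hk.2]
  refine (dimH_mono hsub).trans ?_
  rw [dimH_iUnion]
  refine iSup_le fun N => ?_
  rw [dimH_preimage_expIter fun n => hlam _ (by omega)]
  exact dimH_lower_bounded_le_one (lam := fun i => lam (N₀ + 1 + N + i))
    (a := fun i => a (N₀ + 1 + N + i)) (fun n => hlam _ (by omega)) (fun n => hN₀ _ (by omega))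
    (superGeometric_shift ha0 h (by omega)) (one_le_pow₀ hC)

theorem one_le_dimH_rateSet {lam : ℕ → ℂ} {a b : ℕ → ℝ} {δ q : ℝ}
    (hlam : ∀ n, 1 ≤ n → lam n ≠ 0) (hδ : 0 < δ) (hδ1 : δ ≤ 1) (hq0 : 0 < q) (hq : q < 1)
    (ha0 : ∀ n, 1 ≤ n → 0 < a n) (ha : ∀ᶠ n in atTop, max (64 * Real.pi / δ) (2 / (1 - q)) ≤ a n)
    (hab : ∀ n, 1 ≤ n → a n * Real.exp δ ≤ b n) (hadm : AdmissibleWith lam a b q)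
    (h : Tendsto (fun n : ℕ => (∏ i ∈ Finset.Icc 1 n, a i) ^ (1 / (n : ℝ))) atTop atTop) :
    1 ≤ dimH (rateSet lam a b) := by
  obtain ⟨N, hN⟩ := eventually_atTop.1 ((ha.and hadm).and (eventually_ge_atTop 1))
  have hN1 : 1 ≤ N := (hN N le_rfl).2
  have hN' : ∀ k, max (64 * Real.pi / δ) (2 / (1 - q)) ≤ a (N + k) := fun k =>
    (hN (N + k) (by omega)).1.1
  have h1 := one_le_dimH_of_crossing (lam := fun i => lam (N + i)) (a := fun i => a (N + i))
    (b := fun i => b (N + i)) (fun n => hlam _ (by omega)) hδ hδ1 hq0 hq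
    (fun n => (le_max_left _ _).trans (hN' n)) (fun n => (le_max_right _ _).trans (hN' n))
    (fun n => hab _ (by omega)) (fun n => (hN (N + n) (by omega)).1.2)
    (superGeometric_shift ha0 h hN1)
  rw [← dimH_preimage_expIter (lam := lam) (fun n => hlam _ (by omega)) N] at h1
  refine h1.trans (dimH_mono fun z hz => ?_)
  refine eventually_atTop.2 ⟨N, fun n hn => ?_⟩
  obtain ⟨k, rfl⟩ := Nat.exists_eq_add_of_le hn
  have := hz k
  rwa [expIter_shift] at this

/-! ### Growth hypotheses and conclusion -/

theorem exists_nat_le_exp_of_liminf_lt_top {b : ℕ → ℝ} (hb : ∀ n, 1 ≤ n → 0 < b n)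
    (h : liminf (fun n : ℕ => (((Real.posLog (b n)) ^ (1 / (n : ℝ)) : ℝ) : EReal)) atTop < ⊤) :
    ∃ C : ℕ, ∃ᶠ n : ℕ in atTop, b n ≤ Real.exp (((C : ℝ) + 1) ^ n) := by
  obtain ⟨x, hx, -⟩ := EReal.lt_iff_exists_real_btwn.1 h
  refine ⟨⌈x⌉₊, ((frequently_lt_of_liminf_lt (by isBoundedDefault) hx).and_eventually
    (eventually_ge_atTop 1)).mono fun n hn => ?_⟩
  obtain ⟨hlt, hn1⟩ := hn
  rw [EReal.coe_lt_coe_iff] at hlt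
  rw [← Real.log_le_iff_le_exp (hb n hn1)]
  have hn0 : (n : ℝ) ≠ 0 := by positivity
  have h0 : 0 ≤ Real.posLog (b n) := Real.posLog_nonneg
  calc Real.log (b n) ≤ Real.posLog (b n) := le_max_right _ _
    _ = (Real.posLog (b n) ^ (1 / (n : ℝ))) ^ n := by
        rw [← Real.rpow_natCast, ← Real.rpow_mul h0, one_div, inv_mul_cancel₀ hn0, Real.rpow_one]
    _ ≤ _ := by
        gcongr
        linarith [Nat.le_ceil x]

theorem exists_nat_le_exp_of_mem_modSlowEscapingSet {lam : ℕ → ℂ} {z : ℂ}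
    (hz : z ∈ modSlowEscapingSet lam) :
    ∃ C : ℕ, ∃ᶠ n : ℕ in atTop, ‖expIter lam n z‖ ≤ Real.exp (((C : ℝ) + 1) ^ n) := by
  obtain ⟨hesc, hlim⟩ := hz
  obtain ⟨x, hx, -⟩ := EReal.lt_iff_exists_real_btwn.1 hlim
  refine ⟨⌈Real.exp x⌉₊, Eventually.frequently ?_⟩
  filter_upwards [eventually_lt_of_limsup_lt hx, hesc.eventually_gt_atTop 1,
    eventually_ge_atTop 1] with n hlt hn hn1
  rw [EReal.coe_lt_coe_iff] at hlt
  have hn0 : (0 : ℝ) < n := by positivity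
  have hlog := Real.log_pos hn
  rw [← Real.log_le_iff_le_exp (by linarith)]
  rw [one_div, inv_mul_lt_iff₀ hn0, Real.log_lt_iff_lt_exp hlog, mul_comm, Real.exp_mul,
    Real.rpow_natCast] at hlt
  refine hlt.le.trans ?_
  gcongr
  linarith [Nat.le_ceil (Real.exp x)]

theorem theorem2p5 (Δ : ℝ) (hΔ : 0 < Δ) (q : ℝ) (hq0 : 0 < q) (hq1 : q < 1) :
    ∃ a₀ : ℝ, ∀ (lam : ℕ → ℂ) (a b : ℕ → ℝ),
      (∀ n, 1 ≤ n → lam n ≠ 0) →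
      (∀ n, 1 ≤ n → 0 < a n ∧ a n < b n) →
      AdmissibleWith lam a b q →
      Tendsto (fun n : ℕ => (∏ i ∈ Finset.Icc 1 n, a i) ^ (1 / (n : ℝ))) atTop atTop →
      (∀ n, 1 ≤ n → Δ < annulusModulus a b n) →
      (a₀ : EReal) < liminf (fun n : ℕ => (a n : EReal)) atTop →
      (liminf (fun n : ℕ => (((Real.posLog (b n)) ^ (1 / (n : ℝ)) : ℝ) : EReal)) atTop < ⊤ →
        dimH (rateSet lam a b) = 1) ∧
      (rateSet lam a b ⊆ modSlowEscapingSet lam → dimH (rateSet lam a b) = 1) := by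
  set δ := min Δ 1 with hδ
  have hδ0 : 0 < δ := lt_min hΔ one_pos
  have hδ1 : δ ≤ 1 := min_le_right _ _
  -- The first bound makes the boxes tall enough, the second gives the crossing.
  refine ⟨max (64 * Real.pi / δ) (2 / (1 - q)), fun lam a b hlam hab hadm hgeo hmod hliminf => ?_⟩
  have ha : ∀ᶠ n in atTop, max (64 * Real.pi / δ) (2 / (1 - q)) ≤ a n :=
    (eventually_lt_of_lt_liminf hliminf).mono fun n hn => (EReal.coe_lt_coe_iff.1 hn).le
  have ha4 : ∀ᶠ n in atTop, 4 ≤ a n := ha.mono fun n hn => by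
    refine le_trans ?_ ((le_max_left _ _).trans hn)
    rw [le_div_iff₀ hδ0]
    linarith [Real.pi_gt_three, hδ1]
  have ha0 : ∀ n, 1 ≤ n → 0 < a n := fun n hn => (hab n hn).1
  have hab' : ∀ n, 1 ≤ n → a n * Real.exp δ ≤ b n := fun n hn => by
    have h1 := hmod n hn
    have hb : 0 < b n := (ha0 n hn).trans (hab n hn).2
    rw [annulusModulus, Real.lt_log_iff_exp_lt (div_pos hb (ha0 n hn)),
      lt_div_iff₀ (ha0 n hn), mul_comm] at h1
    refine le_trans ?_ h1.le
    have := (ha0 n hn).le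
    gcongr
    exact min_le_left _ _
  have hlower := one_le_dimH_rateSet hlam hδ0 hδ1 hq0 hq1 ha0 ha hab' hadm hgeo
  have hupper : (∀ z ∈ rateSet lam a b, ∃ C : ℕ, ∃ᶠ n : ℕ in atTop,
      ‖expIter lam n z‖ ≤ Real.exp (((C : ℝ) + 1) ^ n)) → dimH (rateSet lam a b) ≤ 1 := by
    intro hC
    choose! C hC using hC
    -- C may depend on the point; integrality keeps the union countable.
    have hsub : rateSet lam a b ⊆ ⋃ C : ℕ, {z | (∀ᶠ n in atTop, a n ≤ ‖expIter lam n z‖) ∧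
        ∃ᶠ n : ℕ in atTop, ‖expIter lam n z‖ ≤ Real.exp (((C : ℝ) + 1) ^ n)} := fun z hz =>
      Set.mem_iUnion.2 ⟨C z, Eventually.mono hz fun n hn => hn.1, hC z hz⟩
    refine (dimH_mono hsub).trans ?_
    rw [dimH_iUnion]
    exact iSup_le fun C => dimH_eventually_lower_bounded_le_one hlam ha0 hgeo ha4
      (by linarith [Nat.cast_nonneg (α := ℝ) C])
  refine ⟨fun hlim => le_antisymm (hupper fun z hz => ?_) hlower,
    fun hM => le_antisymm (hupper fun z hz => ?_) hlower⟩
  · obtain ⟨C, hC⟩ := exists_nat_le_exp_of_liminf_lt_top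
      (fun n hn => (ha0 n hn).trans (hab n hn).2) hlim
    exact ⟨C, (hC.and_eventually hz).mono fun n hn => hn.2.2.trans hn.1⟩
  · exact exists_nat_le_exp_of_mem_modSlowEscapingSet (hM hz)
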